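/- Let $n\ge 1$. Let $\mathbb U(n)$ be the space of real upper triangular $n\times n$ matrices $m=(m_{i,j})_{1\le i\le j\le n}$, let $\eta_i(m)=m_{i,i}+\sum_{j>i}m_{i,j}-\sum_{j<i}m_{j,i}$ be the $i$-th hook sum of $m$, and for $a\in\mathbb R_{\ge0}^n$ let $$\operatorname{Tes}_n(a)=\{m\in\mathbb U(n): \eta_i(m)=a_i \text{ for } 1\le i\le n,\ m_{i,j}\ge 0 \text{ for } 1\le i\le j\le n\}$$ be the Tesler polytope of hook sum $a$. Let $P\subset\mathbb R^m$ be a polytope with a minimal linear inequality description $Ex=\alpha$, $Gx\le\beta$: the equations define the affine span of $P$, each inequality defines a facet of $P$, and no equation or inequality is redundant. Write $g_i$ for the rows of $G$. A polytope $Q\subset\mathbb R^m$ is a deformation of $P$ if there are vectors $c,b$ such that (1) $Q=\{x: Ex=c,\ Gx\le b\}$ and this description is tight (for each $i$ some $x\in Q$ has $\langle g_i,x\rangle=b_i$); and (2) for every vertex $v$ of $P$, the set $\{x\in Q: \langle g_i,x\rangle=b_i \text{ for all } i \text{ with } \langle g_i,v\rangle=\beta_i\}$ consists of a single vertex of $Q$,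 denoted $\phi(v)$. The deformation is weak if $\phi$ is a bijection from the vertices of $P$ to the vertices of $Q$, and strong otherwise. (These notions do not depend on the chosen minimal description.) Two polytopes are normally equivalent if they have the same normal fan. Theorem. Let $a_0\in\mathbb R_{>0}^n$. Then for every $a=(a_1,\dots,a_n)\in\mathbb R_{\ge0}^n$ the polytope $\operatorname{Tes}_n(a)$ is a deformation of $\operatorname{Tes}_n(a_0)$. More precisely, if $a_1,\dots,a_{n-1}>0$, then $\operatorname{Tes}_n(a)$ is a weak deformation of $\operatorname{Tes}_n(a_0)$ and is normally equivalent to it; if $a_i=0$ for some $1\le i\le n-1$, then $\operatorname{Tes}_n(a)$ is a strong deformation of $\operatorname{Tes}_n(a_0)$. In particular, every $\operatorname{Tes}_n(a)$ with $a\in\mathbb R_{\ge0}^n$ is a deformation of $\operatorname{Tes}_n(1,\dots,1)$. -/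

import Mathlib

open scoped Matrix

/-! ## Polytopes in `ℝ^ι` and minimal linear descriptions -/

/-- A polytope: a bounded set cut out by finitely many linear inequalities `C x ≤ d`. -/
def IsPolytope {ι : Type} [Fintype ι] (P : Set (ι → ℝ)) : Prop :=
  Bornology.IsBounded P ∧
    ∃ (k : ℕ) (C : Matrix (Fin k) ι ℝ) (d : Fin k → ℝ), P = {x | C *ᵥ x ≤ d}

/-- The set of vertices of `P`. -/
def vertices {ι : Type} (P : Set (ι → ℝ)) : Set (ι → ℝ) :=
  Set.extremePoints ℝ P

/-- The dimension of (the affine span of) `P`. -/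
noncomputable def polyDim {ι : Type} (P : Set (ι → ℝ)) : ℕ :=
  Module.finrank ℝ (vectorSpan ℝ P)

/-- A facet of `P`: a nonempty face of dimension one less than that of `P`. -/
def IsFacet {ι : Type} [Fintype ι] (P F : Set (ι → ℝ)) : Prop :=
  F.Nonempty ∧ IsExposed ℝ P F ∧ polyDim F + 1 = polyDim P

/-- The solution set of the system `E x = α`, `G x ≤ β`. -/
def solutionSet {ι ρ κ : Type} [Fintype ι] (E : Matrix ρ ι ℝ) (α : ρ → ℝ)
    (G : Matrix κ ι ℝ) (β : κ → ℝ) : Set (ι → ℝ) :=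
  {x | E *ᵥ x = α ∧ G *ᵥ x ≤ β}

/-- `E x = α`, `G x ≤ β` is a minimal linear inequality description of `P`: it defines `P`,
the equations define the affine span of `P`, each inequality defines a facet of `P`, and none of
the equations or inequalities is redundant. -/
structure IsMinimalDescription {ι ρ κ : Type} [Fintype ι] (P : Set (ι → ℝ))
    (E : Matrix ρ ι ℝ) (α : ρ → ℝ) (G : Matrix κ ι ℝ) (β : κ → ℝ) : Prop where
  eq_solutionSet : P = solutionSet E α G β
  affineSpan_eq : (affineSpan ℝ P : Set (ι → ℝ)) = {x | E *ᵥ x = α}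
  isFacet : ∀ i, IsFacet P {x | x ∈ P ∧ (G *ᵥ x) i = β i}
  eq_irredundant : LinearIndependent ℝ E.row
  ineq_irredundant : ∀ i, {x | E *ᵥ x = α ∧ ∀ j, j ≠ i → (G *ᵥ x) j ≤ β j} ≠ P

/-! ## Deformations -/

/-- The intersection of `Q = {E x = a, G x ≤ b}` with the hyperplanes `⟨g_i, x⟩ = b_i`, over those
`i` for which `v` lies on the facet `⟨g_i, x⟩ = β_i` of `P = {E x = α, G x ≤ β}`. -/
def deformedFace {ι κ : Type} [Fintype ι] (Q : Set (ι → ℝ))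
    (G : Matrix κ ι ℝ) (β b : κ → ℝ) (v : ι → ℝ) : Set (ι → ℝ) :=
  {x | x ∈ Q ∧ ∀ i, (G *ᵥ v) i = β i → (G *ᵥ x) i = b i}

/-- `(a, b)` is a deforming vector for `Q`, as a deformation of `P`, with respect to `(E, G)`, where
`E x = α`, `G x ≤ β` is a minimal description of `P`. The system `E x = a`, `G x ≤ b` is a tight
description of `Q`, and for every vertex `v` of `P` the set `deformedFace Q G β b v` is a vertex
of `Q`. -/
structure IsDeformingVector {ι ρ κ : Type} [Fintype ι] (P : Set (ι → ℝ))
    (E : Matrix ρ ι ℝ) (G : Matrix κ ι ℝ) (β : κ → ℝ)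
    (Q : Set (ι → ℝ)) (a : ρ → ℝ) (b : κ → ℝ) : Prop where
  eq_solutionSet : Q = solutionSet E a G b
  tight : ∀ i, ∃ x ∈ Q, (G *ᵥ x) i = b i
  vertex : ∀ v ∈ vertices P, ∃ w ∈ vertices Q, deformedFace Q G β b v = {w}

/-- `Q` is a deformation of `P`. (The choice of the minimal description of `P` is immaterial.) -/
def IsDeformation {ι : Type} [Fintype ι] (P Q : Set (ι → ℝ)) : Prop :=
  IsPolytope P ∧ IsPolytope Q ∧
    ∃ (ρ κ : Type) (_ : Finite ρ) (_ : Finite κ) (E : Matrix ρ ι ℝ) (α : ρ → ℝ)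
      (G : Matrix κ ι ℝ) (β : κ → ℝ), IsMinimalDescription P E α G β ∧
      ∃ (a : ρ → ℝ) (b : κ → ℝ), IsDeformingVector P E G β Q a b

/-- `Q` is a weak deformation of `P`: a deformation for which the map sending a vertex `v` of `P` to
the unique element of `deformedFace Q G β b v` is a bijection from the vertices of `P` to the
vertices of `Q`. -/
def IsWeakDeformation {ι : Type} [Fintype ι] (P Q : Set (ι → ℝ)) : Prop :=
  IsPolytope P ∧ IsPolytope Q ∧
    ∃ (ρ κ : Type) (_ : Finite ρ) (_ : Finite κ) (E : Matrix ρ ι ℝ) (α : ρ → ℝ)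
      (G : Matrix κ ι ℝ) (β : κ → ℝ), IsMinimalDescription P E α G β ∧
      ∃ (a : ρ → ℝ) (b : κ → ℝ), IsDeformingVector P E G β Q a b ∧
        ∃ φ : vertices P → vertices Q,
          (∀ v : vertices P, deformedFace Q G β b (v : ι → ℝ) = {(φ v : ι → ℝ)}) ∧
          Function.Bijective φ

/-- `Q` is a strong deformation of `P`: a deformation that is not a weak one. -/
def IsStrongDeformation {ι : Type} [Fintype ι] (P Q : Set (ι → ℝ)) : Prop :=
  IsDeformation P Q ∧ ¬ IsWeakDeformation P Q

/-! ## Normal fans -/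

/-- The normal cone of `P` at a face `F`: the functionals maximized over `P` at every point
of `F`. -/
def normalCone {ι : Type} [Fintype ι] (P F : Set (ι → ℝ)) : Set (ι → ℝ) :=
  {c | ∀ x ∈ F, ∀ y ∈ P, c ⬝ᵥ y ≤ c ⬝ᵥ x}

/-- The normal fan of `P`: the collection of the normal cones at the nonempty faces of `P`. -/
def normalFan {ι : Type} [Fintype ι] (P : Set (ι → ℝ)) : Set (Set (ι → ℝ)) :=
  {N | ∃ F : Set (ι → ℝ), IsExposed ℝ P F ∧ F.Nonempty ∧ N = normalCone P F}

/-- Two polytopes are normally equivalent if they have the same normal fan. -/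
def NormallyEquivalent {ι : Type} [Fintype ι] (P Q : Set (ι → ℝ)) : Prop :=
  normalFan P = normalFan Q

/-! ## Tesler polytopes -/

/-- The positions `(i, j)`, `i ≤ j`, of an upper triangular `n × n` matrix. -/
abbrev UpperPos (n : ℕ) : Type := {p : Fin n × Fin n // p.1 ≤ p.2}

/-- The `i`-th hook sum `m_{i,i} + ∑_{i<j} m_{i,j} - ∑_{j<i} m_{j,i}`. -/
def hookSum {n : ℕ} (m : UpperPos n → ℝ) (i : Fin n) : ℝ :=
  m ⟨(i, i), le_rfl⟩ + ∑ j : {j : Fin n // i < j}, m ⟨(i, j.1), le_of_lt j.2⟩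
    - ∑ j : {j : Fin n // j < i}, m ⟨(j.1, i), le_of_lt j.2⟩

/-- The Tesler polytope of hook sum `a`. -/
def tesler {n : ℕ} (a : Fin n → ℝ) : Set (UpperPos n → ℝ) :=
  {m | hookSum m = a ∧ ∀ p, 0 ≤ m p}

/-! Tes_n(a) is a flow polytope: row i receives a_i together with the entries above its diagonal
position, and distributes this total among its own entries. Flow only moves to later rows, so a
point is determined by a and by the proportions used in each row (`eq_flow`). Concentrating each row
on one position gives exactly the vertices, for every a ≥ 0 (`mem_vertices_tesler_iff`). The last
row has a single position and offers no choice.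

For a₀ > 0, the hook equations and the inequalities x_p ≥ 0 with p outside the last row form a
minimal description, whose matrices do not involve a₀ (`isMinimalDescription_tesler`). With
right-hand sides (a, 0) they describe Tes_n(a) tightly, and the deformation map carries the vertex
of a row choice to the vertex of the same choice (`deformedFace_tesler`). If a is positive before
the last row, supports recover choices there and this map is bijective. If some such a_i vanishes,
row i can be starved of flow, so two choices coincide and Tes_n(a) has too few vertices for any
bijection.

Normal fans are compared by linear programming duality. Longest paths give a potential for c,
independent of a, and the face maximizing c consists of the points supported on the tight positions
of this potential (`isMaxOn_tesler_iff`). When a is positive before the last row, the normal cones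
depend only on these tight sets (`normalFan_tesler`). -/

/-! ## Hook sums as row sum minus inflow -/

section HookSums

variable {n : ℕ}

/-- The sum of the entries in row `i`. -/
noncomputable def rowSum (m : UpperPos n → ℝ) (i : Fin n) : ℝ :=
  ∑ p : UpperPos n, if p.1.1 = i then m p else 0

/-- The sum of the entries of column `i` strictly above the diagonal. -/
noncomputable def inflow (m : UpperPos n → ℝ) (i : Fin n) : ℝ :=
  ∑ p : UpperPos n, if p.1.1 < p.1.2 ∧ p.1.2 = i then m p else 0

lemma hookSum_eq (m : UpperPos n → ℝ) (i : Fin n) :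
    hookSum m i = rowSum m i - inflow m i := by
  have h1 : rowSum m i = m ⟨(i, i), le_rfl⟩ +
      ∑ j : {j : Fin n // i < j}, m ⟨(i, j.1), le_of_lt j.2⟩ := by
    have hinj : Function.Injective
        (fun j : {j : Fin n // i < j} => (⟨(i, j.1), le_of_lt j.2⟩ : UpperPos n)) := by
      intro j k h
      simpa [Subtype.ext_iff] using h
    have hs : Finset.univ.filter (fun p : UpperPos n => p.1.1 = i) =
        insert ⟨(i, i), le_rfl⟩ (Finset.univ.map ⟨_, hinj⟩) := by
      ext ⟨⟨x, y⟩, hxy⟩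
      simp only [Finset.mem_filter, Finset.mem_univ, true_and, Finset.mem_insert,
        Finset.mem_map, Function.Embedding.coeFn_mk, Subtype.mk.injEq, Prod.mk.injEq,
        Subtype.exists]
      simp only at hxy
      constructor
      · rintro rfl
        rcases hxy.eq_or_lt with h | h
        · exact Or.inl ⟨rfl, h.symm⟩
        · exact Or.inr ⟨y, h, rfl, rfl⟩
      · rintro (h | ⟨_, _, h, _⟩)
        · exact h.1
        · exact h.symm
    rw [rowSum, ← Finset.sum_filter, hs, Finset.sum_insert, Finset.sum_map]
    · rfl
    · simp [Subtype.ext_iff]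
  have h2 : inflow m i = ∑ j : {j : Fin n // j < i}, m ⟨(j.1, i), le_of_lt j.2⟩ := by
    have hinj : Function.Injective
        (fun j : {j : Fin n // j < i} => (⟨(j.1, i), le_of_lt j.2⟩ : UpperPos n)) := by
      intro j k h
      simpa [Subtype.ext_iff] using h
    have hs : Finset.univ.filter (fun p : UpperPos n => p.1.1 < p.1.2 ∧ p.1.2 = i) =
        Finset.univ.map ⟨_, hinj⟩ := by
      ext ⟨⟨x, y⟩, hxy⟩
      simp only [Finset.mem_filter, Finset.mem_univ, true_and,
        Finset.mem_map, Function.Embedding.coeFn_mk, Subtype.mk.injEq, Prod.mk.injEq,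
        Subtype.exists]
      constructor
      · rintro ⟨h, rfl⟩
        exact ⟨x, h, rfl, rfl⟩
      · rintro ⟨j, h, rfl, rfl⟩
        exact ⟨h, rfl⟩
    rw [inflow, ← Finset.sum_filter, hs, Finset.sum_map]
    rfl
  rw [hookSum, h1, h2]

lemma mem_tesler_iff {a : Fin n → ℝ} {m : UpperPos n → ℝ} :
    m ∈ tesler a ↔ (∀ i, rowSum m i = a i + inflow m i) ∧ ∀ p, 0 ≤ m p := by
  simp only [tesler, Set.mem_ofPred_eq, funext_iff, hookSum_eq, sub_eq_iff_eq_add]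

lemma inflow_nonneg {m : UpperPos n → ℝ} (hm : ∀ p, 0 ≤ m p) (i : Fin n) : 0 ≤ inflow m i :=
  Finset.sum_nonneg fun p _ => by split_ifs <;> simp [hm]

lemma rowSum_nonneg {m : UpperPos n → ℝ} (hm : ∀ p, 0 ≤ m p) (i : Fin n) : 0 ≤ rowSum m i :=
  Finset.sum_nonneg fun p _ => by split_ifs <;> simp [hm]

lemma le_rowSum {m : UpperPos n → ℝ} (hm : ∀ p, 0 ≤ m p) (p : UpperPos n) :
    m p ≤ rowSum m p.1.1 := by
  have := Finset.single_le_sum (f := fun q : UpperPos n => if q.1.1 = p.1.1 then m q else 0)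
    (fun q _ => by split_ifs <;> simp [hm]) (Finset.mem_univ p)
  simpa [rowSum] using this

lemma rowSum_eq_single {m : UpperPos n → ℝ} {p : UpperPos n}
    (h : ∀ q : UpperPos n, q.1.1 = p.1.1 → q ≠ p → m q = 0) : rowSum m p.1.1 = m p := by
  rw [rowSum, Finset.sum_eq_single p]
  · simp
  · intro q _ hq
    split_ifs with hr
    · exact h q hr hq
    · rfl
  · simp

lemma hookSum_add (x y : UpperPos n → ℝ) : hookSum (x + y) = hookSum x + hookSum y := by
  ext i
  simp only [hookSum, Pi.add_apply, Finset.sum_add_distrib]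
  ring

lemma hookSum_smul (t : ℝ) (x : UpperPos n → ℝ) : hookSum (t • x) = t • hookSum x := by
  ext i
  simp only [hookSum, Pi.smul_apply, smul_eq_mul, ← Finset.mul_sum]
  ring

/-- The hook sums as a linear map. -/
noncomputable def hookLin (n : ℕ) : (UpperPos n → ℝ) →ₗ[ℝ] (Fin n → ℝ) where
  toFun := hookSum
  map_add' := hookSum_add
  map_smul' := hookSum_smul

@[simp] lemma hookLin_apply (m : UpperPos n → ℝ) : hookLin n m = hookSum m := rfl

lemma rowSum_add (x y : UpperPos n → ℝ) (i : Fin n) :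
    rowSum (x + y) i = rowSum x i + rowSum y i := by
  simp only [rowSum, ← Finset.sum_add_distrib, Pi.add_apply]
  exact Finset.sum_congr rfl fun p _ => by split_ifs <;> simp

lemma rowSum_smul (t : ℝ) (x : UpperPos n → ℝ) (i : Fin n) :
    rowSum (t • x) i = t * rowSum x i := by
  simp only [rowSum, Finset.mul_sum, Pi.smul_apply, smul_eq_mul, mul_ite, mul_zero]

/-- Summation by parts of the hook sums against a potential. -/
lemma sum_mul_hookSum (V : Fin n → ℝ) (m : UpperPos n → ℝ) :
    ∑ i, V i * hookSum m i =
      ∑ p : UpperPos n, (V p.1.1 - if p.1.1 < p.1.2 then V p.1.2 else 0) * m p := by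
  simp only [hookSum_eq, rowSum, inflow, mul_sub, Finset.sum_sub_distrib, sub_mul, Finset.mul_sum]
  congr 1
  · rw [Finset.sum_comm]
    refine Finset.sum_congr rfl fun p _ => ?_
    simp
  · rw [Finset.sum_comm]
    refine Finset.sum_congr rfl fun p _ => ?_
    by_cases h : p.1.1 < p.1.2 <;> simp [h]

end HookSums

/-! ## Points of Tesler polytopes with prescribed row proportions -/

section Flow

variable {n : ℕ}

/-- The row sums of the point with hook sums `a` and row proportions `L`. -/
noncomputable def flowRow (L : UpperPos n → ℝ) (a : Fin n → ℝ) (i : Fin n) : ℝ :=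
  a i + ∑ p : UpperPos n,
    if _h : p.1.1 < p.1.2 ∧ p.1.2 = i then L p * flowRow L a p.1.1 else 0
termination_by i.val
decreasing_by exact _h.2 ▸ _h.1

/-- The point with hook sums `a` and row proportions `L`. -/
noncomputable def flow (L : UpperPos n → ℝ) (a : Fin n → ℝ) (p : UpperPos n) : ℝ :=
  L p * flowRow L a p.1.1

lemma flowRow_eq (L : UpperPos n → ℝ) (a : Fin n → ℝ) (i : Fin n) :
    flowRow L a i = a i + inflow (flow L a) i := by
  rw [flowRow, inflow]
  simp only [flow, dite_eq_ite]

lemma flowRow_nonneg {L : UpperPos n → ℝ} {a : Fin n → ℝ} (hL : ∀ p, 0 ≤ L p)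
    (ha : ∀ i, 0 ≤ a i) (i : Fin n) : 0 ≤ flowRow L a i := by
  induction i using WellFoundedLT.induction with
  | ind i ih =>
    rw [flowRow]
    refine add_nonneg (ha i) (Finset.sum_nonneg fun p _ => ?_)
    split_ifs with h
    · exact mul_nonneg (hL p) (ih _ (h.2 ▸ h.1))
    · exact le_rfl

lemma flow_nonneg {L : UpperPos n → ℝ} {a : Fin n → ℝ} (hL : ∀ p, 0 ≤ L p)
    (ha : ∀ i, 0 ≤ a i) (p : UpperPos n) : 0 ≤ flow L a p :=
  mul_nonneg (hL p) (flowRow_nonneg hL ha _)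

lemma le_flowRow {L : UpperPos n → ℝ} {a : Fin n → ℝ} (hL : ∀ p, 0 ≤ L p)
    (ha : ∀ i, 0 ≤ a i) (i : Fin n) : a i ≤ flowRow L a i := by
  rw [flowRow_eq]
  exact le_add_of_nonneg_right (inflow_nonneg (flow_nonneg hL ha) i)

lemma flowRow_congr {L L' : UpperPos n → ℝ} {a : Fin n → ℝ} {i : Fin n}
    (h : ∀ p : UpperPos n, p.1.1 < i → L p = L' p) : flowRow L a i = flowRow L' a i := by
  induction i using WellFoundedLT.induction with
  | ind i ih =>
    rw [flowRow, flowRow]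
    congr 1
    refine Finset.sum_congr rfl fun p _ => ?_
    split_ifs with hp
    · have hlt : p.1.1 < i := hp.2 ▸ hp.1
      rw [h p hlt, ih _ hlt fun q hq => h q (hq.trans hlt)]
    · rfl

/-- `L` is a system of row proportions. -/
structure IsRowStochastic (L : UpperPos n → ℝ) : Prop where
  nonneg : ∀ p, 0 ≤ L p
  rowSum_eq : ∀ i, rowSum L i = 1

lemma rowSum_flow {L : UpperPos n → ℝ} (hL : IsRowStochastic L) (a : Fin n → ℝ) (i : Fin n) :
    rowSum (flow L a) i = flowRow L a i := by
  have : rowSum (flow L a) i = rowSum L i * flowRow L a i := by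
    simp only [rowSum, flow, Finset.sum_mul]
    refine Finset.sum_congr rfl fun p _ => ?_
    split_ifs with h
    · rw [h]
    · simp
  rw [this, hL.rowSum_eq, one_mul]

lemma flow_mem_tesler {L : UpperPos n → ℝ} (hL : IsRowStochastic L) {a : Fin n → ℝ}
    (ha : ∀ i, 0 ≤ a i) : flow L a ∈ tesler a :=
  mem_tesler_iff.2 ⟨fun i => by rw [rowSum_flow hL, flowRow_eq], flow_nonneg hL.nonneg ha⟩

/-- A point is determined by its hook sums and its row proportions. -/
lemma eq_flow {L x : UpperPos n → ℝ} {a : Fin n → ℝ}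
    (hx : ∀ i, rowSum x i = a i + inflow x i) (hL : ∀ p, x p = L p * rowSum x p.1.1) :
    x = flow L a := by
  have key : ∀ i, rowSum x i = flowRow L a i := by
    intro i
    induction i using WellFoundedLT.induction with
    | ind i ih =>
      rw [hx, inflow, flowRow]
      congr 1
      refine Finset.sum_congr rfl fun p _ => ?_
      split_ifs with h
      · rw [hL p, ih _ (h.2 ▸ h.1)]
      · rfl
  ext p
  rw [hL p, key, flow]

/-- Proportions identically 1 pass the whole row total on to every entry, which overestimates every
feasible flow. This is the bound behind `isBounded_tesler`. -/
lemma rowSum_le_flowRow_one {a : Fin n → ℝ} {x : UpperPos n → ℝ} (hx : x ∈ tesler a)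
    (i : Fin n) : rowSum x i ≤ flowRow 1 a i := by
  rw [mem_tesler_iff] at hx
  induction i using WellFoundedLT.induction with
  | ind i ih =>
    rw [hx.1, inflow, flowRow]
    gcongr with p
    split_ifs with h
    · rw [Pi.one_apply, one_mul]
      exact (le_rowSum hx.2 p).trans (ih _ (h.2 ▸ h.1))
    · rfl

/-- The uniform row proportions on a set `T` of positions. -/
noncomputable def spread (T : Set (UpperPos n)) (p : UpperPos n) : ℝ :=
  T.indicator 1 p / rowSum (T.indicator 1) p.1.1

/-- `T` contains a position in every row. -/
def MeetsRows (T : Set (UpperPos n)) : Prop := ∀ i : Fin n, ∃ p ∈ T, p.1.1 = i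

lemma indicator_one_nonneg (T : Set (UpperPos n)) (p : UpperPos n) :
    (0 : ℝ) ≤ T.indicator 1 p :=
  Set.indicator_nonneg (fun _ _ => zero_le_one) p

lemma rowSum_indicator_pos {T : Set (UpperPos n)} (hT : MeetsRows T) (i : Fin n) :
    0 < rowSum (T.indicator 1) i := by
  obtain ⟨p, hp, rfl⟩ := hT i
  refine lt_of_lt_of_le ?_ (le_rowSum (indicator_one_nonneg T) p)
  simp [hp]

lemma isRowStochastic_spread {T : Set (UpperPos n)} (hT : MeetsRows T) :
    IsRowStochastic (spread T) where
  nonneg p := div_nonneg (indicator_one_nonneg T p) (rowSum_nonneg (indicator_one_nonneg T) _)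
  rowSum_eq i := by
    have : rowSum (spread T) i = rowSum (T.indicator 1) i / rowSum (T.indicator 1) i := by
      simp only [rowSum, Finset.sum_div]
      refine Finset.sum_congr rfl fun p _ => ?_
      split_ifs with h
      · rw [spread, h, rowSum]
      · simp
    rw [this, div_self (rowSum_indicator_pos hT i).ne']

/-- The point of the Tesler polytope with uniform row proportions on `T`. -/
noncomputable def spreadPoint (T : Set (UpperPos n)) (a : Fin n → ℝ) : UpperPos n → ℝ :=
  flow (spread T) a

lemma spreadPoint_mem {T : Set (UpperPos n)} (hT : MeetsRows T) {a : Fin n → ℝ}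
    (ha : ∀ i, 0 ≤ a i) : spreadPoint T a ∈ tesler a :=
  flow_mem_tesler (isRowStochastic_spread hT) ha

lemma spreadPoint_eq_zero {T : Set (UpperPos n)} (a : Fin n → ℝ) {p : UpperPos n} (hp : p ∉ T) :
    spreadPoint T a p = 0 := by
  simp [spreadPoint, flow, spread, hp]

lemma spreadPoint_pos {T : Set (UpperPos n)} (hT : MeetsRows T) {a : Fin n → ℝ}
    (ha : ∀ i, 0 ≤ a i) {p : UpperPos n} (hp : p ∈ T) (hpos : 0 < a p.1.1) :
    0 < spreadPoint T a p := by
  have h1 : 0 < spread T p := div_pos (by simp [hp]) (rowSum_indicator_pos hT _)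
  exact mul_pos h1 (hpos.trans_le (le_flowRow (isRowStochastic_spread hT).nonneg ha _))

end Flow

/-! ## Vertices of Tesler polytopes -/

section Vertices

variable {n : ℕ}

/-- `c` chooses a position in every row. -/
def IsRowChoice (c : Fin n → UpperPos n) : Prop := ∀ i, (c i).1.1 = i

lemma IsRowChoice.mem_range_iff {c : Fin n → UpperPos n} (hc : IsRowChoice c) {p : UpperPos n} :
    p ∈ Set.range c ↔ c p.1.1 = p :=
  ⟨by rintro ⟨i, rfl⟩; rw [hc], fun h => ⟨_, h⟩⟩

lemma IsRowChoice.meetsRows {c : Fin n → UpperPos n} (hc : IsRowChoice c) :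
    MeetsRows (Set.range c) :=
  fun i => ⟨c i, ⟨i, rfl⟩, hc i⟩

/-- The last row contains only its diagonal position, which is why it is exempt from the facet
inequalities and from the positivity hypotheses on a. -/
lemma eq_of_mem_last_row {p q : UpperPos n} (hp : ¬ (p.1.1 : ℕ) + 1 < n) (h : q.1.1 = p.1.1) :
    q = p := by
  obtain ⟨⟨x, y⟩, hxy⟩ := p
  obtain ⟨⟨x', y'⟩, hxy'⟩ := q
  simp only at h hp hxy hxy'
  subst h
  have := y.2
  have := y'.2
  rw [Fin.le_def] at hxy hxy'
  simp only [Subtype.mk.injEq, Prod.mk.injEq, true_and, Fin.ext_iff]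
  omega

lemma MeetsRows.mem_last_row {T : Set (UpperPos n)} (hT : MeetsRows T) {p : UpperPos n}
    (hp : ¬ (p.1.1 : ℕ) + 1 < n) : p ∈ T := by
  obtain ⟨q, hq, h⟩ := hT p.1.1
  exact eq_of_mem_last_row hp h ▸ hq

/-- A point of the Tesler polytope is determined by its hook sums if it has at most one nonzero
entry in each row, at a given place. -/
lemma eq_spreadPoint_range {c : Fin n → UpperPos n} (hc : IsRowChoice c) {a : Fin n → ℝ}
    {x : UpperPos n → ℝ} (hx : x ∈ tesler a) (h : ∀ p, p ∉ Set.range c → x p = 0) :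
    x = spreadPoint (Set.range c) a := by
  rw [mem_tesler_iff] at hx
  refine eq_flow hx.1 fun p => ?_
  by_cases hp : p ∈ Set.range c
  · have hne : ∀ q : UpperPos n, q.1.1 = p.1.1 → q ≠ p → q ∉ Set.range c := by
      intro q hq hqp hqr
      rw [hc.mem_range_iff] at hp hqr
      exact hqp (by rw [← hqr, hq, hp])
    rw [rowSum_eq_single fun q hq hqp => h q (hne q hq hqp), spread,
      rowSum_eq_single fun q hq hqp => Set.indicator_of_notMem (hne q hq hqp) _]
    simp [Set.indicator_of_mem hp]
  · rw [h p hp, spread, Set.indicator_of_notMem hp, zero_div, zero_mul]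

/-- Nonnegativity forces both ends of a segment through the point to vanish off the chosen
positions, and `eq_spreadPoint_range` leaves only one such point. -/
lemma spreadPoint_range_mem_vertices {c : Fin n → UpperPos n} (hc : IsRowChoice c)
    {a : Fin n → ℝ} (ha : ∀ i, 0 ≤ a i) :
    spreadPoint (Set.range c) a ∈ vertices (tesler a) := by
  refine mem_extremePoints.2 ⟨spreadPoint_mem hc.meetsRows ha, ?_⟩
  intro y hy z hz hyz
  obtain ⟨s, t, hs, ht, -, hst⟩ := hyz
  have hzero : ∀ p, p ∉ Set.range c → y p = 0 ∧ z p = 0 := by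
    intro p hp
    have h := congrFun hst p
    rw [spreadPoint_eq_zero a hp] at h
    simp only [Pi.add_apply, Pi.smul_apply, smul_eq_mul] at h
    have h1 := mul_nonneg hs.le (hy.2 p)
    have h2 := mul_nonneg ht.le (hz.2 p)
    have h3 : s * y p = 0 := by linarith
    have h4 : t * z p = 0 := by linarith
    exact ⟨(mul_eq_zero.1 h3).resolve_left hs.ne', (mul_eq_zero.1 h4).resolve_left ht.ne'⟩
  exact ⟨eq_spreadPoint_range hc hy fun p hp => (hzero p hp).1,
    eq_spreadPoint_range hc hz fun p hp => (hzero p hp).2⟩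

/-- The row proportions of a nonnegative matrix, with the diagonal chosen in vanishing rows. -/
lemma exists_isRowStochastic_eq_flow {a : Fin n → ℝ} {x : UpperPos n → ℝ} (hx : x ∈ tesler a) :
    ∃ L, IsRowStochastic L ∧ x = flow L a := by
  rw [mem_tesler_iff] at hx
  -- Rows with zero sum are given uniform proportions over the whole row; any stochastic choice
  -- there yields the same point.
  set D : UpperPos n → ℝ := spread Set.univ with hD
  have hDs : IsRowStochastic D := isRowStochastic_spread fun i => ⟨⟨(i, i), le_rfl⟩, trivial, rfl⟩
  refine ⟨fun p => if rowSum x p.1.1 = 0 then D p else x p / rowSum x p.1.1, ⟨fun p => ?_, ?_⟩,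
    eq_flow hx.1 fun p => ?_⟩
  · split_ifs
    · exact hDs.nonneg p
    · exact div_nonneg (hx.2 p) (rowSum_nonneg hx.2 _)
  · intro i
    by_cases h : rowSum x i = 0
    · rw [← hDs.rowSum_eq i]
      refine Finset.sum_congr rfl fun p _ => ?_
      by_cases hp : p.1.1 = i
      · simp [hp, h]
      · simp [hp]
    · rw [← div_self h]
      conv_rhs => enter [1]; rw [rowSum]
      rw [Finset.sum_div]
      refine Finset.sum_congr rfl fun p _ => ?_
      by_cases hp : p.1.1 = i
      · simp [hp, h]
      · simp [hp]
  · split_ifs with h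
    · rw [h, mul_zero]
      exact le_antisymm (h ▸ le_rowSum hx.2 p) (hx.2 p)
    · rw [div_mul_cancel₀ _ h]

/-- The points with given row proportions depend affinely on the proportions in a single row. -/
lemma flow_combination {L M N : UpperPos n → ℝ} {a : Fin n → ℝ} {i : Fin n} {s t : ℝ}
    (hM : IsRowStochastic M) (hN : IsRowStochastic N) (hst : s + t = 1)
    (hLM : ∀ p : UpperPos n, p.1.1 ≠ i → M p = L p) (hLN : ∀ p : UpperPos n, p.1.1 ≠ i → N p = L p)
    (hL : ∀ p : UpperPos n, p.1.1 = i → L p = s * M p + t * N p) :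
    s • flow M a + t • flow N a = flow L a := by
  have hinflow : ∀ j, inflow (s • flow M a + t • flow N a) j =
      s * inflow (flow M a) j + t * inflow (flow N a) j := by
    intro j
    simp only [inflow, Finset.mul_sum, ← Finset.sum_add_distrib]
    exact Finset.sum_congr rfl fun p _ => by split_ifs <;> simp
  refine eq_flow (fun j => ?_) fun p => ?_
  · rw [rowSum_add, rowSum_smul, rowSum_smul, hinflow, rowSum_flow hM, rowSum_flow hN, flowRow_eq,
      flowRow_eq]
    linear_combination a j * hst
  · rw [rowSum_add, rowSum_smul, rowSum_smul, rowSum_flow hM, rowSum_flow hN]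
    simp only [Pi.add_apply, Pi.smul_apply, smul_eq_mul, flow]
    by_cases hp : p.1.1 = i
    -- The total of row i involves only earlier rows, where M and N agree, so the combination is not
    -- distorted by different row totals.
    · have : flowRow M a p.1.1 = flowRow N a p.1.1 := by
        refine flowRow_congr fun q hq => ?_
        rw [hLM q (hp ▸ hq.ne), hLN q (hp ▸ hq.ne)]
      rw [this, hL p hp]
      linear_combination (-(s * M p + t * N p) * flowRow N a p.1.1) * hst
    · rw [hLM p hp, hLN p hp]
      ring

/-- A vertex of a Tesler polytope has at most one nonzero entry in each row. -/
lemma eq_of_mem_vertices_tesler {a : Fin n → ℝ} (ha : ∀ i, 0 ≤ a i) {x : UpperPos n → ℝ}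
    (hx : x ∈ vertices (tesler a)) {p q : UpperPos n} (hpq : q.1.1 = p.1.1) (hp : x p ≠ 0)
    (hq : x q ≠ 0) : q = p := by
  by_contra hne
  obtain ⟨hxm, hext⟩ := mem_extremePoints.1 hx
  obtain ⟨L, hL, rfl⟩ := exists_isRowStochastic_eq_flow hxm
  have hLp : 0 < L p := (hL.nonneg p).lt_of_ne' (left_ne_zero_of_mul hp)
  have hLq : 0 < L q := (hL.nonneg q).lt_of_ne' (left_ne_zero_of_mul hq)
  have hlt : L p < 1 := by
    rw [← hL.rowSum_eq p.1.1, rowSum]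
    refine lt_of_lt_of_le (lt_add_of_pos_right _ hLq) ?_
    have := Finset.add_le_sum (s := Finset.univ)
      (f := fun r : UpperPos n => if r.1.1 = p.1.1 then L r else 0)
      (fun r _ => by split_ifs <;> simp [hL.nonneg]) (Finset.mem_univ p) (Finset.mem_univ q)
      (Ne.symm hne)
    simpa [hpq] using this
  set t := L p with ht
  have ht1 : 0 < 1 - t := by linarith
  -- M sends the whole row of p to p; N removes p and rescales the rest by 1/(1 - t). Hence L = t M
  -- + (1 - t) N in this row, and extremality will force `flow M a = flow L a`, although the former
  -- vanishes at q.
  set M : UpperPos n → ℝ := fun r => if r.1.1 = p.1.1 then (if r = p then 1 else 0) else L r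
  set N : UpperPos n → ℝ := fun r => if r.1.1 = p.1.1 then (if r = p then 0 else L r / (1 - t))
    else L r
  have hM : IsRowStochastic M := by
    refine ⟨fun r => ?_, fun i => ?_⟩
    · simp only [M]
      split_ifs <;> simp [hL.nonneg]
    · by_cases hi : i = p.1.1
      · subst hi
        rw [rowSum_eq_single (p := p)]
        · simp [M]
        · intro r hr hrp
          simp [M, hr, hrp]
      · rw [← hL.rowSum_eq i]
        refine Finset.sum_congr rfl fun r _ => ?_
        by_cases hr : r.1.1 = i
        · simp [M, hr, hi]
        · simp [hr]
  have hN : IsRowStochastic N := by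
    refine ⟨fun r => ?_, fun i => ?_⟩
    · simp only [N]
      split_ifs
      · exact le_rfl
      · exact div_nonneg (hL.nonneg _) ht1.le
      · exact hL.nonneg _
    · by_cases hi : i = p.1.1
      · subst hi
        have h1 : (1 - t) • N + t • M = L := by
          ext r
          simp only [N, M, Pi.add_apply, Pi.smul_apply, smul_eq_mul]
          split_ifs with h1 h2
          · rw [h2, ht]; ring
          · rw [mul_div_cancel₀ _ ht1.ne']; ring
          · ring
        have h2 := hL.rowSum_eq p.1.1
        rw [← h1, rowSum_add, rowSum_smul, rowSum_smul, hM.rowSum_eq] at h2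
        have : (1 - t) * (rowSum N p.1.1 - 1) = 0 := by linarith
        linarith [(mul_eq_zero.1 this).resolve_left ht1.ne']
      · rw [← hL.rowSum_eq i]
        refine Finset.sum_congr rfl fun r _ => ?_
        by_cases hr : r.1.1 = i
        · simp [N, hr, hi]
        · simp [hr]
  have hcomb : t • flow M a + (1 - t) • flow N a = flow L a := by
    refine flow_combination (i := p.1.1) hM hN (by ring) (fun r hr => by simp [M, hr])
      (fun r hr => by simp [N, hr]) fun r hr => ?_
    by_cases h : r = p
    · subst h; simp [M, N, ht]
    · simp only [M, N, if_pos hr, if_neg h]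
      rw [mul_div_cancel₀ _ ht1.ne']; ring
  have := (hext _ (flow_mem_tesler hM ha) _ (flow_mem_tesler hN ha)
    ⟨t, 1 - t, hLp, ht1, by ring, hcomb⟩).1
  apply hq
  rw [← this, flow]
  simp [M, hpq, hne]

/-- The vertices of a Tesler polytope are the points supported on one position in each row. -/
lemma mem_vertices_tesler_iff {a : Fin n → ℝ} (ha : ∀ i, 0 ≤ a i) {x : UpperPos n → ℝ} :
    x ∈ vertices (tesler a) ↔
      ∃ c : Fin n → UpperPos n, IsRowChoice c ∧ spreadPoint (Set.range c) a = x := by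
  constructor
  · intro hx
    have hc : ∀ i : Fin n, ∃ p : UpperPos n, p.1.1 = i ∧
        ∀ q : UpperPos n, q.1.1 = i → x q ≠ 0 → q = p := by
      intro i
      by_cases h : ∃ p : UpperPos n, p.1.1 = i ∧ x p ≠ 0
      · obtain ⟨p, rfl, hp⟩ := h
        exact ⟨p, rfl, fun q hq hq0 => eq_of_mem_vertices_tesler ha hx hq hp hq0⟩
      · push Not at h
        exact ⟨⟨(i, i), le_rfl⟩, rfl, fun q hq hq0 => absurd (h q hq) hq0⟩
    choose c hc hcx using hc
    have hcc : IsRowChoice c := hc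
    refine ⟨c, hcc, (eq_spreadPoint_range hcc (extremePoints_subset hx) fun p hp => ?_).symm⟩
    by_contra h
    exact hp (hcc.mem_range_iff.2 (hcx _ p rfl h).symm)
  · rintro ⟨c, hc, rfl⟩
    exact spreadPoint_range_mem_vertices hc ha

/-- The support of `spreadPoint T a`, if the hook sums before the last one are positive. -/
lemma spreadPoint_eq_zero_iff {T : Set (UpperPos n)} (hT : MeetsRows T) {a : Fin n → ℝ}
    (ha : ∀ i, 0 ≤ a i) (hpos : ∀ i : Fin n, (i : ℕ) + 1 < n → 0 < a i) {p : UpperPos n}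
    (hp : (p.1.1 : ℕ) + 1 < n) : spreadPoint T a p = 0 ↔ p ∉ T :=
  ⟨fun h hpT => (spreadPoint_pos hT ha hpT (hpos _ hp)).ne' h, spreadPoint_eq_zero a⟩

end Vertices

/-! ## Tesler polytopes are polytopes -/

section Polytope

variable {n : ℕ}

lemma isPolytope_of_fintype {ι κ : Type} [Fintype ι] [Fintype κ] {P : Set (ι → ℝ)}
    (hP : Bornology.IsBounded P) (C : Matrix κ ι ℝ) (d : κ → ℝ) (h : P = {x | C *ᵥ x ≤ d}) :
    IsPolytope P := by
  refine ⟨hP, Fintype.card κ, C.submatrix (Fintype.equivFin κ).symm id,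
    d ∘ (Fintype.equivFin κ).symm, ?_⟩
  rw [h]
  ext x
  simp only [Set.mem_ofPred_eq, Pi.le_def, (Fintype.equivFin κ).symm.forall_congr_left]
  simp [Matrix.mulVec]

/-- The matrix of the hook sums. -/
noncomputable def hookMatrix (n : ℕ) : Matrix (Fin n) (UpperPos n) ℝ :=
  LinearMap.toMatrix' (hookLin n)

@[simp] lemma hookMatrix_mulVec (m : UpperPos n → ℝ) : hookMatrix n *ᵥ m = hookSum m := by
  rw [hookMatrix, LinearMap.toMatrix'_mulVec, hookLin_apply]

lemma isBounded_tesler (a : Fin n → ℝ) : Bornology.IsBounded (tesler a) := by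
  refine (Metric.isBounded_Icc (0 : UpperPos n → ℝ) fun p => flowRow 1 a p.1.1).subset ?_
  intro x hx
  exact ⟨hx.2, fun p => (le_rowSum hx.2 p).trans (rowSum_le_flowRow_one hx _)⟩

lemma isPolytope_tesler (a : Fin n → ℝ) : IsPolytope (tesler a) := by
  refine isPolytope_of_fintype (isBounded_tesler a)
    (Matrix.fromRows (hookMatrix n) (Matrix.fromRows (-hookMatrix n) (-1 : Matrix (UpperPos n) (UpperPos n) ℝ)))
    (Sum.elim a (Sum.elim (-a) 0)) ?_
  ext x
  simp only [tesler, Set.mem_ofPred_eq, Matrix.fromRows_mulVec, Sum.elim_le_elim_iff,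
    Matrix.neg_mulVec, hookMatrix_mulVec, Matrix.one_mulVec, neg_le_neg_iff]
  rw [← and_assoc, ← le_antisymm_iff]
  simp [Pi.le_def]

end Polytope

/-! ## The minimal description of a Tesler polytope -/

section Description

variable {n : ℕ}

/-- The positions that do not lie in the last row; they index the facets. -/
abbrev FacetPos (n : ℕ) : Type := {p : UpperPos n // (p.1.1 : ℕ) + 1 < n}

/-- The matrix of the inequalities `-m p ≤ 0`, where `p` is not in the last row. -/
def facetMatrix (n : ℕ) : Matrix (FacetPos n) (UpperPos n) ℝ :=
  Matrix.of fun k q => if k.1 = q then -1 else 0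

@[simp] lemma facetMatrix_mulVec (m : UpperPos n → ℝ) (k : FacetPos n) :
    (facetMatrix n *ᵥ m) k = -m k.1 := by
  simp [facetMatrix, Matrix.mulVec, dotProduct]

lemma facetMatrix_mulVec_le_zero {m : UpperPos n → ℝ} :
    facetMatrix n *ᵥ m ≤ 0 ↔ ∀ k : FacetPos n, 0 ≤ m k.1 := by
  simp [Pi.le_def]

/-- The missing inequality in the last row is implied: that entry equals its hook sum plus an inflow
made of entries of earlier rows. -/
lemma tesler_eq_solutionSet {a : Fin n → ℝ} (ha : ∀ i, 0 ≤ a i) :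
    tesler a = solutionSet (hookMatrix n) a (facetMatrix n) 0 := by
  ext x
  simp only [tesler, solutionSet, Set.mem_ofPred_eq, hookMatrix_mulVec, facetMatrix_mulVec_le_zero]
  refine and_congr_right fun hx => ⟨fun h k => h k, fun h p => ?_⟩
  by_cases hp : (p.1.1 : ℕ) + 1 < n
  · exact h ⟨p, hp⟩
  · have h1 : rowSum x p.1.1 = x p :=
      rowSum_eq_single fun q hq hqp => absurd (eq_of_mem_last_row hp hq) hqp
    have h2 := congrFun hx p.1.1
    rw [hookSum_eq, h1] at h2
    have h3 : 0 ≤ inflow x p.1.1 := by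
      refine Finset.sum_nonneg fun q _ => ?_
      split_ifs with hq
      · refine h ⟨q, ?_⟩
        have := q.1.2.2
        have := Fin.lt_def.1 hq.1
        omega
      · exact le_rfl
    linarith [ha p.1.1]

/-- The point x₀ acts as a relative interior point: every direction of V is a multiple of a
difference of two points of S. -/
lemma vectorSpan_eq_of_relInterior {E : Type*} [AddCommGroup E] [Module ℝ E] {S : Set E}
    (V : Submodule ℝ E) {x₀ : E} (hx₀ : x₀ ∈ S) (hS : ∀ x ∈ S, x - x₀ ∈ V)
    (h : ∀ v ∈ V, ∃ t : ℝ, 0 < t ∧ x₀ + t • v ∈ S) : vectorSpan ℝ S = V := by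
  rw [vectorSpan_eq_span_vsub_set_right ℝ hx₀]
  refine le_antisymm (Submodule.span_le.2 ?_) fun v hv => ?_
  · rintro _ ⟨x, hx, rfl⟩
    exact hS x hx
  · obtain ⟨t, ht, hmem⟩ := h v hv
    have h1 : t • v ∈ Submodule.span ℝ ((fun x => x -ᵥ x₀) '' S) :=
      Submodule.subset_span ⟨_, hmem, by simp⟩
    simpa [smul_smul, inv_mul_cancel₀ ht.ne'] using Submodule.smul_mem _ t⁻¹ h1

lemma exists_pos_add_smul_nonneg {ι : Type*} [Finite ι] {T : Set ι} {x : ι → ℝ} (v : ι → ℝ)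
    (hx : ∀ p ∈ T, 0 < x p) : ∃ t : ℝ, 0 < t ∧ ∀ p ∈ T, 0 ≤ (x + t • v) p := by
  have h1 : ∀ᶠ t : ℝ in nhdsWithin 0 (Set.Ioi 0), ∀ p : ι, p ∈ T → 0 ≤ (x + t • v) p := by
    rw [Filter.eventually_all]
    intro p
    by_cases hp : p ∈ T
    · have hc : Filter.Tendsto (fun t : ℝ => (x + t • v) p) (nhdsWithin 0 (Set.Ioi 0))
          (nhds ((x + (0 : ℝ) • v) p)) := by
        refine (Continuous.tendsto ?_ 0).mono_left nhdsWithin_le_nhds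
        simp only [Pi.add_apply, Pi.smul_apply, smul_eq_mul]
        fun_prop
      have h0 : 0 < (x + (0 : ℝ) • v) p := by simpa using hx p hp
      filter_upwards [hc.eventually (lt_mem_nhds h0)] with t ht _
      exact ht.le
    · exact Filter.Eventually.of_forall fun t h => absurd h hp
  obtain ⟨t, h, ht⟩ := (h1.and self_mem_nhdsWithin).exists
  exact ⟨t, ht, h⟩

/-- The matrices with vanishing hook sums supported in `T`. -/
noncomputable def circulations (T : Set (UpperPos n)) : Submodule ℝ (UpperPos n → ℝ) :=
  LinearMap.ker (hookLin n) ⊓ ⨅ p ∈ Tᶜ, LinearMap.ker (LinearMap.proj p)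

lemma mem_circulations {T : Set (UpperPos n)} {v : UpperPos n → ℝ} :
    v ∈ circulations T ↔ hookSum v = 0 ∧ ∀ p, p ∉ T → v p = 0 := by
  simp [circulations]

lemma hookSum_sub (x y : UpperPos n → ℝ) : hookSum (x - y) = hookSum x - hookSum y :=
  (hookLin n).map_sub x y

/-- The point `spreadPoint T a` is positive throughout T, so it can be moved slightly along any
circulation supported in T. -/
lemma vectorSpan_tesler_face {T : Set (UpperPos n)} (hT : MeetsRows T) {a : Fin n → ℝ}
    (ha : ∀ i, 0 < a i) :
    vectorSpan ℝ {x | x ∈ tesler a ∧ ∀ p, p ∉ T → x p = 0} = circulations T := by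
  have ha' : ∀ i, 0 ≤ a i := fun i => (ha i).le
  refine vectorSpan_eq_of_relInterior _ (x₀ := spreadPoint T a)
    ⟨spreadPoint_mem hT ha', fun p hp => spreadPoint_eq_zero a hp⟩ (fun x hx => ?_) fun v hv => ?_
  · rw [mem_circulations, hookSum_sub, hx.1.1, (spreadPoint_mem hT ha').1, sub_self]
    refine ⟨rfl, fun p hp => ?_⟩
    rw [Pi.sub_apply, hx.2 p hp, spreadPoint_eq_zero a hp, sub_self]
  · rw [mem_circulations] at hv
    obtain ⟨t, ht, h⟩ := exists_pos_add_smul_nonneg v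
      fun p (hp : p ∈ T) => spreadPoint_pos hT ha' hp (ha _)
    have hz : ∀ p, p ∉ T → (spreadPoint T a + t • v) p = 0 := by
      intro p hp
      simp [spreadPoint_eq_zero a hp, hv.2 p hp]
    refine ⟨t, ht, ⟨?_, fun p => ?_⟩, hz⟩
    · rw [hookSum_add, hookSum_smul, hv.1, (spreadPoint_mem hT ha').1, smul_zero, add_zero]
    · by_cases hp : p ∈ T
      · exact h p hp
      · exact (hz p hp).ge

lemma meetsRows_univ : MeetsRows (Set.univ : Set (UpperPos n)) :=
  fun i => ⟨⟨(i, i), le_rfl⟩, trivial, rfl⟩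

/-- A row before the last has at least two positions, so its flow can avoid any one of them. -/
lemma meetsRows_compl_singleton (k : FacetPos n) : MeetsRows ({k.1}ᶜ : Set (UpperPos n)) := by
  intro i
  by_cases h : (⟨(i, i), le_rfl⟩ : UpperPos n) = k.1
  · have hk := k.2
    rw [← h] at hk
    refine ⟨⟨(i, ⟨i + 1, hk⟩), Fin.le_def.2 (Nat.le_succ _)⟩, ?_, rfl⟩
    rw [Set.mem_compl_singleton_iff, ← h]
    simp [Fin.ext_iff]
  · exact ⟨_, h, rfl⟩

lemma vectorSpan_tesler {a : Fin n → ℝ} (ha : ∀ i, 0 < a i) :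
    vectorSpan ℝ (tesler a) = circulations Set.univ := by
  rw [← vectorSpan_tesler_face meetsRows_univ ha]
  simp

lemma affineSpan_tesler {a : Fin n → ℝ} (ha : ∀ i, 0 < a i) :
    (affineSpan ℝ (tesler a) : Set (UpperPos n → ℝ)) = {x | hookMatrix n *ᵥ x = a} := by
  have hx₀ := spreadPoint_mem (meetsRows_univ (n := n)) fun i => (ha i).le
  ext x
  rw [SetLike.mem_coe, ← AffineSubspace.vsub_right_mem_direction_iff_mem
    (subset_affineSpan ℝ _ hx₀), direction_affineSpan, vectorSpan_tesler ha, mem_circulations,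
    vsub_eq_sub, hookSum_sub, hx₀.1]
  simp [sub_eq_zero]

/-- Rank-nullity for the k-th coordinate on circulations. It is nonzero there because two points
with hook sums 1, one using k and one avoiding it, differ by a circulation. -/
lemma finrank_circulations_compl_singleton (k : FacetPos n) :
    Module.finrank ℝ (circulations ({k.1}ᶜ : Set (UpperPos n))) + 1 =
      Module.finrank ℝ (circulations (Set.univ : Set (UpperPos n))) := by
  set V := circulations (Set.univ : Set (UpperPos n)) with hV
  set f : V →ₗ[ℝ] ℝ := (LinearMap.proj k.1).comp V.subtype with hf
  have hker : circulations ({k.1}ᶜ : Set (UpperPos n)) = (LinearMap.ker f).map V.subtype := by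
    ext v
    simp [mem_circulations, hf, hV, and_comm]
  have hone : ∀ i : Fin n, (0 : ℝ) ≤ (1 : Fin n → ℝ) i := fun _ => zero_le_one
  set x := spreadPoint (Set.univ : Set (UpperPos n)) 1
  set y := spreadPoint ({k.1}ᶜ : Set (UpperPos n)) 1
  have hxy : x - y ∈ V := by
    rw [hV, mem_circulations, hookSum_sub, (spreadPoint_mem meetsRows_univ hone).1,
      (spreadPoint_mem (meetsRows_compl_singleton k) hone).1]
    simp
  have hne : f ⟨x - y, hxy⟩ ≠ 0 := by
    have h1 : 0 < x k.1 := spreadPoint_pos meetsRows_univ hone trivial one_pos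
    have h2 : y k.1 = 0 := spreadPoint_eq_zero _ (by simp)
    simp [hf, h2, h1.ne']
  have hsurj : LinearMap.range f = ⊤ :=
    LinearMap.range_eq_top.2 (LinearMap.surjective fun h => hne (by rw [h]; rfl))
  have := f.finrank_range_add_finrank_ker
  rw [hsurj, finrank_top, Module.finrank_self] at this
  rw [hker, LinearEquiv.finrank_eq (Submodule.equivSubtypeMap V (LinearMap.ker f)).symm]
  omega

lemma isFacet_tesler {a : Fin n → ℝ} (ha : ∀ i, 0 < a i) (k : FacetPos n) :
    IsFacet (tesler a) {x | x ∈ tesler a ∧ x k.1 = 0} := by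
  have ha' : ∀ i, 0 ≤ a i := fun i => (ha i).le
  have hy := spreadPoint_mem (meetsRows_compl_singleton k) ha'
  have hyk : spreadPoint ({k.1}ᶜ : Set (UpperPos n)) a k.1 = 0 := spreadPoint_eq_zero _ (by simp)
  refine ⟨⟨_, hy, hyk⟩, fun _ => ⟨-ContinuousLinearMap.proj k.1, ?_⟩, ?_⟩
  · ext x
    simp only [Set.mem_ofPred_eq, neg_apply, ContinuousLinearMap.proj_apply,
      neg_le_neg_iff]
    refine and_congr_right fun hx => ⟨fun h z hz => h ▸ hz.2 _, fun h => ?_⟩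
    exact le_antisymm (hyk ▸ h _ hy) (hx.2 _)
  · have h : {x | x ∈ tesler a ∧ x k.1 = 0} =
        {x | x ∈ tesler a ∧ ∀ p, p ∉ ({k.1}ᶜ : Set (UpperPos n)) → x p = 0} := by
      ext x
      simp
    rw [polyDim, polyDim, h, vectorSpan_tesler_face (meetsRows_compl_singleton k) ha,
      vectorSpan_tesler ha, finrank_circulations_compl_singleton]

lemma linearIndependent_hookMatrix_row (n : ℕ) : LinearIndependent ℝ (hookMatrix n).row := by
  rw [Fintype.linearIndependent_iff]
  intro g hg i
  have h := congrFun hg ⟨(i, i), le_rfl⟩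
  -- A diagonal position enters only its own hook sum, so the diagonal columns form an identity
  -- matrix.
  have hcol : ∀ j, hookMatrix n j ⟨(i, i), le_rfl⟩ = if j = i then 1 else 0 := by
    intro j
    rw [hookMatrix, LinearMap.toMatrix'_apply, hookLin_apply, hookSum_eq]
    have h1 : inflow (Pi.single (⟨(i, i), le_rfl⟩ : UpperPos n) (1 : ℝ)) j = 0 := by
      refine Finset.sum_eq_zero fun p _ => ?_
      split_ifs with hp
      · refine Pi.single_eq_of_ne ?_ _
        rintro rfl
        exact lt_irrefl _ hp.1
      · rfl
    have h2 : rowSum (Pi.single (⟨(i, i), le_rfl⟩ : UpperPos n) (1 : ℝ)) j =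
        if j = i then 1 else 0 := by
      rw [rowSum, Finset.sum_eq_single (⟨(i, i), le_rfl⟩ : UpperPos n)]
      · simp [eq_comm]
      · intro p _ hp
        simp [Pi.single_eq_of_ne hp]
      · simp
    rw [← sub_zero (ite _ _ _), ← h2, ← h1]
  simpa [Matrix.row, hcol] using h

theorem isMinimalDescription_tesler {a : Fin n → ℝ} (ha : ∀ i, 0 < a i) :
    IsMinimalDescription (tesler a) (hookMatrix n) a (facetMatrix n) 0 where
  eq_solutionSet := tesler_eq_solutionSet fun i => (ha i).le
  affineSpan_eq := affineSpan_tesler ha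
  isFacet k := by simpa using isFacet_tesler ha k
  eq_irredundant := linearIndependent_hookMatrix_row n
  ineq_irredundant k h := by
    have ha' : ∀ i, 0 ≤ a i := fun i => (ha i).le
    set x := spreadPoint (Set.univ : Set (UpperPos n)) a
    set y := spreadPoint ({k.1}ᶜ : Set (UpperPos n)) a
    have hx : x ∈ tesler a := spreadPoint_mem meetsRows_univ ha'
    have hy : y ∈ tesler a := spreadPoint_mem (meetsRows_compl_singleton k) ha'
    have hxk : 0 < x k.1 := spreadPoint_pos meetsRows_univ ha' trivial (ha _)
    have hyk : y k.1 = 0 := spreadPoint_eq_zero _ (by simp)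
    obtain ⟨t, ht, hpos⟩ := exists_pos_add_smul_nonneg (y - x)
      fun p (hp : p ∈ ({k.1}ᶜ : Set (UpperPos n))) =>
        spreadPoint_pos (meetsRows_compl_singleton k) ha' hp (ha _)
    have hmem : y + t • (y - x) ∈ tesler a := by
      rw [← h]
      refine ⟨?_, fun j hj => ?_⟩
      · rw [hookMatrix_mulVec, hookSum_add, hookSum_smul, hookSum_sub, hx.1, hy.1, sub_self,
          smul_zero, add_zero]
      · rw [facetMatrix_mulVec, Pi.zero_apply, neg_nonpos]
        exact hpos _ fun h => hj (Subtype.ext h)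
    have h0 := hmem.2 k.1
    simp only [Pi.add_apply, Pi.smul_apply, Pi.sub_apply, smul_eq_mul, hyk] at h0
    nlinarith [mul_pos ht hxk]

end Description

/-! ## Deformations of Tesler polytopes -/

section Deformation

variable {n : ℕ}

/-- Since a₀ > 0, the inequalities tight at the given vertex are exactly those at unchosen
positions. Imposing them on Tes_n(a) leaves one position per row. -/
lemma deformedFace_tesler {a₀ a : Fin n → ℝ} (ha₀ : ∀ i, 0 < a₀ i) (ha : ∀ i, 0 ≤ a i)
    {c : Fin n → UpperPos n} (hc : IsRowChoice c) :
    deformedFace (tesler a) (facetMatrix n) 0 0 (spreadPoint (Set.range c) a₀) =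
      {spreadPoint (Set.range c) a} := by
  ext x
  simp only [deformedFace, Set.mem_ofPred_eq, facetMatrix_mulVec, Pi.zero_apply, neg_eq_zero,
    Set.mem_singleton_iff]
  constructor
  · rintro ⟨hx, h⟩
    refine eq_spreadPoint_range hc hx fun p hp => ?_
    exact h ⟨p, by_contra fun hlast => hp (hc.meetsRows.mem_last_row hlast)⟩
      (spreadPoint_eq_zero a₀ hp)
  · rintro rfl
    refine ⟨spreadPoint_mem hc.meetsRows ha, fun k hk => spreadPoint_eq_zero a ?_⟩
    exact (spreadPoint_eq_zero_iff hc.meetsRows (fun i => (ha₀ i).le) (fun i _ => ha₀ i) k.2).1 hk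

lemma isDeformingVector_tesler {a₀ a : Fin n → ℝ} (ha₀ : ∀ i, 0 < a₀ i) (ha : ∀ i, 0 ≤ a i) :
    IsDeformingVector (tesler a₀) (hookMatrix n) (facetMatrix n) 0 (tesler a) a 0 where
  eq_solutionSet := tesler_eq_solutionSet ha
  tight k := ⟨_, spreadPoint_mem (meetsRows_compl_singleton k) ha, by
    rw [facetMatrix_mulVec, spreadPoint_eq_zero _ (by simp), neg_zero, Pi.zero_apply]⟩
  vertex v hv := by
    obtain ⟨c, hc, rfl⟩ := (mem_vertices_tesler_iff fun i => (ha₀ i).le).1 hv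
    exact ⟨_, spreadPoint_range_mem_vertices hc ha, deformedFace_tesler ha₀ ha hc⟩

theorem isDeformation_tesler {a₀ a : Fin n → ℝ} (ha₀ : ∀ i, 0 < a₀ i) (ha : ∀ i, 0 ≤ a i) :
    IsDeformation (tesler a₀) (tesler a) :=
  ⟨isPolytope_tesler a₀, isPolytope_tesler a, Fin n, FacetPos n, inferInstance, inferInstance,
    hookMatrix n, a₀, facetMatrix n, 0, isMinimalDescription_tesler ha₀, a, 0,
    isDeformingVector_tesler ha₀ ha⟩

/-- The vertex of a Tesler polytope supported on a choice of one position in each row. -/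
noncomputable def choiceVertex {a : Fin n → ℝ} (ha : ∀ i, 0 ≤ a i)
    (c : {c : Fin n → UpperPos n // IsRowChoice c}) : vertices (tesler a) :=
  ⟨spreadPoint (Set.range c.1) a, spreadPoint_range_mem_vertices c.2 ha⟩

lemma choiceVertex_surjective {a : Fin n → ℝ} (ha : ∀ i, 0 ≤ a i) :
    Function.Surjective (choiceVertex ha) := by
  rintro ⟨x, hx⟩
  obtain ⟨c, hc, h⟩ := (mem_vertices_tesler_iff ha).1 hx
  exact ⟨⟨c, hc⟩, Subtype.ext h⟩

lemma choiceVertex_injective {a : Fin n → ℝ} (ha : ∀ i, 0 ≤ a i)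
    (hpos : ∀ i : Fin n, (i : ℕ) + 1 < n → 0 < a i) : Function.Injective (choiceVertex ha) := by
  rintro ⟨c, hc⟩ ⟨d, hd⟩ h
  have h' : spreadPoint (Set.range c) a = spreadPoint (Set.range d) a := congrArg Subtype.val h
  refine Subtype.ext (funext fun i => ?_)
  by_cases hi : ((d i).1.1 : ℕ) + 1 < n
  · have h1 : spreadPoint (Set.range d) a (d i) ≠ 0 := fun h0 =>
      (spreadPoint_eq_zero_iff hd.meetsRows ha hpos hi).1 h0 ⟨i, rfl⟩
    rw [← h'] at h1
    have h2 : d i ∈ Set.range c := by_contra fun h2 => h1 (spreadPoint_eq_zero a h2)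
    rwa [hc.mem_range_iff, hd] at h2
  · exact eq_of_mem_last_row hi (by rw [hc, hd])

/-- A hook sum that vanishes before the last row makes two choices give the same vertex. -/
lemma choiceVertex_not_injective {a : Fin n → ℝ} (ha : ∀ i, 0 ≤ a i) {i : Fin n}
    (hi : (i : ℕ) + 1 < n) (hai : a i = 0) : ¬ Function.Injective (choiceVertex ha) := by
  have hn : n - 1 < n := by omega
  -- Every row sends its flow straight to the last column, so nothing enters row i; as a_i = 0, its
  -- total is 0 and changing the choice there has no effect.
  let c : Fin n → UpperPos n := fun j =>
    ⟨(j, ⟨n - 1, hn⟩), Fin.le_def.2 (Nat.le_sub_one_of_lt j.2)⟩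
  have hc : IsRowChoice c := fun _ => rfl
  let d : Fin n → UpperPos n := Function.update c i ⟨(i, i), le_rfl⟩
  have hd : IsRowChoice d := by
    intro j
    by_cases h : j = i
    · subst h; simp [d]
    · simp [d, h, hc j]
  have hrow : flowRow (spread (Set.range c)) a i = 0 := by
    rw [flowRow_eq, hai, zero_add, inflow]
    refine Finset.sum_eq_zero fun p _ => ?_
    split_ifs with hp
    · refine spreadPoint_eq_zero a ?_
      rintro ⟨j, rfl⟩
      have := hp.2
      simp only [c, Fin.ext_iff] at this
      omega
    · rfl
  intro hinj
  have heq : spreadPoint (Set.range c) a = spreadPoint (Set.range d) a := by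
    refine eq_spreadPoint_range hd (spreadPoint_mem hc.meetsRows ha) fun p hp => ?_
    by_cases hpi : p.1.1 = i
    · rw [spreadPoint, flow, hpi, hrow, mul_zero]
    · refine spreadPoint_eq_zero a fun hpc => hp ?_
      rw [hd.mem_range_iff]
      rw [hc.mem_range_iff] at hpc
      simpa [d, hpi] using hpc
  have hcd : c = d := congrArg Subtype.val
    (@hinj ⟨c, hc⟩ ⟨d, hd⟩ (Subtype.ext heq))
  have := congrFun hcd i
  simp only [c, d, Function.update_self, Subtype.mk.injEq, Prod.mk.injEq, Fin.ext_iff] at this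
  omega

theorem isWeakDeformation_tesler {a₀ a : Fin n → ℝ} (ha₀ : ∀ i, 0 < a₀ i) (ha : ∀ i, 0 ≤ a i)
    (hpos : ∀ i : Fin n, (i : ℕ) + 1 < n → 0 < a i) :
    IsWeakDeformation (tesler a₀) (tesler a) := by
  have ha₀' : ∀ i, 0 ≤ a₀ i := fun i => (ha₀ i).le
  refine ⟨isPolytope_tesler a₀, isPolytope_tesler a, Fin n, FacetPos n, inferInstance,
    inferInstance, hookMatrix n, a₀, facetMatrix n, 0, isMinimalDescription_tesler ha₀, a, 0,
    isDeformingVector_tesler ha₀ ha, ?_⟩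
  let e := Equiv.ofBijective (choiceVertex ha₀')
    ⟨choiceVertex_injective ha₀' fun i _ => ha₀ i, choiceVertex_surjective ha₀'⟩
  let f := Equiv.ofBijective (choiceVertex ha)
    ⟨choiceVertex_injective ha hpos, choiceVertex_surjective ha⟩
  refine ⟨e.symm.trans f, fun v => ?_, (e.symm.trans f).bijective⟩
  obtain ⟨c, rfl⟩ := e.surjective v
  rw [Equiv.trans_apply, e.symm_apply_apply]
  exact deformedFace_tesler ha₀ ha c.2

/-- A weak deformation could be witnessed by any minimal description, so the argument only counts
vertices: equal counts would make the surjection from row choices onto the vertices of Tes_n(a)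
injective. -/
theorem isStrongDeformation_tesler {a₀ a : Fin n → ℝ} (ha₀ : ∀ i, 0 < a₀ i) (ha : ∀ i, 0 ≤ a i)
    {i : Fin n} (hi : (i : ℕ) + 1 < n) (hai : a i = 0) :
    IsStrongDeformation (tesler a₀) (tesler a) := by
  have ha₀' : ∀ i, 0 ≤ a₀ i := fun i => (ha₀ i).le
  refine ⟨isDeformation_tesler ha₀ ha, ?_⟩
  rintro ⟨-, -, -, -, -, -, -, -, -, -, -, -, -, -, φ, -, hφ⟩
  have h₀ : Function.Bijective (choiceVertex ha₀') :=
    ⟨choiceVertex_injective ha₀' fun i _ => ha₀ i, choiceVertex_surjective ha₀'⟩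
  have hcard := Nat.card_eq_of_bijective _ (hφ.comp h₀)
  exact choiceVertex_not_injective ha hi hai
    ((choiceVertex_surjective ha).bijective_of_nat_card_le hcard.le).injective

end Deformation

/-! ## The normal fan of a Tesler polytope -/

section NormalFan

variable {n : ℕ}

/-- The largest cost of a path starting in row `i`, where the step at a position `p` costs `c p`,
a step at a diagonal position ends the path and the other ones lead to row `p.1.2`. -/
noncomputable def potential (c : UpperPos n → ℝ) (i : Fin n) : ℝ :=
  Finset.univ.sup' (⟨⟨i, le_rfl⟩, Finset.mem_univ _⟩ :
      (Finset.univ : Finset {j : Fin n // i ≤ j}).Nonempty)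
    fun j => c ⟨(i, j.1), j.2⟩ + if _h : i < j.1 then potential c j.1 else 0
termination_by n - i.val
decreasing_by have := Fin.lt_def.1 _h; have := j.1.2; omega

/-- The slack of the potential at a position. -/
noncomputable def slack (c : UpperPos n → ℝ) (p : UpperPos n) : ℝ :=
  potential c p.1.1 - (if p.1.1 < p.1.2 then potential c p.1.2 else 0) - c p

/-- The positions at which the potential is attained. -/
def tightSet (c : UpperPos n → ℝ) : Set (UpperPos n) := {p | slack c p = 0}

lemma slack_nonneg (c : UpperPos n → ℝ) (p : UpperPos n) : 0 ≤ slack c p := by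
  obtain ⟨⟨i, j⟩, hij⟩ := p
  have h := Finset.le_sup' (fun j : {j : Fin n // i ≤ j} =>
    c ⟨(i, j.1), j.2⟩ + if _h : i < j.1 then potential c j.1 else 0) (Finset.mem_univ ⟨j, hij⟩)
  rw [← potential] at h
  simp only [dite_eq_ite] at h
  simp only [slack]
  linarith

/-- The maximum defining the potential is attained in each row, so feasible flows supported on tight
positions exist. -/
lemma meetsRows_tightSet (c : UpperPos n → ℝ) : MeetsRows (tightSet c) := by
  intro i
  obtain ⟨j, -, hj⟩ := Finset.exists_mem_eq_sup' (⟨⟨i, le_rfl⟩, Finset.mem_univ _⟩ :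
      (Finset.univ : Finset {j : Fin n // i ≤ j}).Nonempty)
    fun j => c ⟨(i, j.1), j.2⟩ + if _h : i < j.1 then potential c j.1 else 0
  rw [← potential] at hj
  simp only [dite_eq_ite] at hj
  refine ⟨⟨(i, j.1), j.2⟩, ?_, rfl⟩
  simp only [tightSet, Set.mem_ofPred_eq, slack]
  linarith

/-- Weak duality in exact form: the first sum depends only on a and c, and the slack term measures
the distance to optimality. -/
lemma dotProduct_eq_sub_slack {a : Fin n → ℝ} {x : UpperPos n → ℝ} (hx : x ∈ tesler a)
    (c : UpperPos n → ℝ) : c ⬝ᵥ x = ∑ i, potential c i * a i - ∑ p, slack c p * x p := by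
  rw [← hx.1, sum_mul_hookSum, dotProduct, ← Finset.sum_sub_distrib]
  refine Finset.sum_congr rfl fun p _ => ?_
  rw [slack]
  ring

lemma sum_slack_nonneg {a : Fin n → ℝ} {x : UpperPos n → ℝ} (hx : x ∈ tesler a)
    (c : UpperPos n → ℝ) : 0 ≤ ∑ p, slack c p * x p :=
  Finset.sum_nonneg fun p _ => mul_nonneg (slack_nonneg c p) (hx.2 p)

lemma sum_slack_eq_zero_iff {a : Fin n → ℝ} {x : UpperPos n → ℝ} (hx : x ∈ tesler a)
    (c : UpperPos n → ℝ) : ∑ p, slack c p * x p = 0 ↔ ∀ p, p ∉ tightSet c → x p = 0 := by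
  rw [Finset.sum_eq_zero_iff_of_nonneg fun p _ => mul_nonneg (slack_nonneg c p) (hx.2 p)]
  simp only [Finset.mem_univ, true_implies, mul_eq_zero]
  exact forall_congr' fun p => or_iff_not_imp_left

/-- The maximizers of a linear functional over a Tesler polytope. -/
lemma isMaxOn_tesler_iff {a : Fin n → ℝ} (ha : ∀ i, 0 ≤ a i) {x : UpperPos n → ℝ}
    (hx : x ∈ tesler a) (c : UpperPos n → ℝ) :
    (∀ y ∈ tesler a, c ⬝ᵥ y ≤ c ⬝ᵥ x) ↔ ∀ p, p ∉ tightSet c → x p = 0 := by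
  rw [← sum_slack_eq_zero_iff hx]
  constructor
  · intro h
    have hy := spreadPoint_mem (meetsRows_tightSet c) ha
    have h1 := h _ hy
    rw [dotProduct_eq_sub_slack hx, dotProduct_eq_sub_slack hy,
      (sum_slack_eq_zero_iff hy c).2 fun p hp => spreadPoint_eq_zero a hp] at h1
    linarith [sum_slack_nonneg hx c]
  · intro h y hy
    rw [dotProduct_eq_sub_slack hx, dotProduct_eq_sub_slack hy, h]
    linarith [sum_slack_nonneg hy c]

/-- The normal cone at the face maximizing `c` depends only on the tight positions of `c`. -/
lemma normalCone_tesler {a : Fin n → ℝ} (ha : ∀ i, 0 ≤ a i)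
    (hpos : ∀ i : Fin n, (i : ℕ) + 1 < n → 0 < a i) (c : UpperPos n → ℝ) :
    normalCone (tesler a) {x | x ∈ tesler a ∧ ∀ y ∈ tesler a, c ⬝ᵥ y ≤ c ⬝ᵥ x} =
      {d | tightSet c ⊆ tightSet d} := by
  ext d
  simp only [normalCone, Set.mem_ofPred_eq]
  constructor
  · intro h p hp
    by_contra hpd
    have hT := meetsRows_tightSet c
    -- This single maximizer of c is positive at all tight positions before the last row, so it
    -- detects whether they are tight for d as well.
    have hx := spreadPoint_mem hT ha
    have h1 := (isMaxOn_tesler_iff ha hx d).1 (h _ ⟨hx, (isMaxOn_tesler_iff ha hx c).2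
      fun q hq => spreadPoint_eq_zero a hq⟩) p hpd
    by_cases hlast : (p.1.1 : ℕ) + 1 < n
    · exact (spreadPoint_eq_zero_iff hT ha hpos hlast).1 h1 hp
    -- In the last row the entry may vanish, but its only position is tight for every functional.
    · exact hpd ((meetsRows_tightSet d).mem_last_row hlast)
  · rintro h x ⟨hx, hmax⟩
    rw [isMaxOn_tesler_iff ha hx] at hmax ⊢
    exact fun p hp => hmax p fun hpc => hp (h hpc)

lemma exists_dotProduct_eq {ι : Type} [Fintype ι] (l : StrongDual ℝ (ι → ℝ)) :
    ∃ c : ι → ℝ, ∀ x, l x = c ⬝ᵥ x := by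
  classical
  refine ⟨fun i => l (Pi.single i 1), fun x => ?_⟩
  rw [dotProduct_comm]
  conv_lhs => rw [← ContinuousLinearMap.coe_coe, LinearMap.pi_apply_eq_sum_univ]
  simp only [dotProduct, smul_eq_mul, ContinuousLinearMap.coe_coe]
  refine Finset.sum_congr rfl fun i _ => ?_
  congr 2
  ext j
  simp [Pi.single_apply, eq_comm]

theorem normalFan_tesler {a : Fin n → ℝ} (ha : ∀ i, 0 ≤ a i)
    (hpos : ∀ i : Fin n, (i : ℕ) + 1 < n → 0 < a i) :
    normalFan (tesler a) = Set.range fun c : UpperPos n → ℝ => {d | tightSet c ⊆ tightSet d} := by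
  ext N
  constructor
  · rintro ⟨F, hF, hne, rfl⟩
    obtain ⟨l, rfl⟩ := hF hne
    obtain ⟨c, hc⟩ := exists_dotProduct_eq l
    refine ⟨c, ?_⟩
    simp only [hc]
    exact (normalCone_tesler ha hpos c).symm
  · rintro ⟨c, rfl⟩
    refine ⟨_, fun _ => ⟨LinearMap.toContinuousLinearMap (dotProductBilin ℝ ℝ c), rfl⟩, ?_,
      (normalCone_tesler ha hpos c).symm⟩
    have hx := spreadPoint_mem (meetsRows_tightSet c) ha
    exact ⟨_, hx, (isMaxOn_tesler_iff ha hx c).2 fun p hp => spreadPoint_eq_zero a hp⟩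

end NormalFan

theorem mainTheorem2 (n : ℕ) (hn : 1 ≤ n) (a₀ : Fin n → ℝ) (ha₀ : ∀ i, 0 < a₀ i)
    (a : Fin n → ℝ) (ha : ∀ i, 0 ≤ a i) :
    IsDeformation (tesler a₀) (tesler a) ∧
    ((∀ i : Fin n, (i : ℕ) + 1 < n → 0 < a i) →
      IsWeakDeformation (tesler a₀) (tesler a) ∧
      NormallyEquivalent (tesler a₀) (tesler a)) ∧
    ((∃ i : Fin n, (i : ℕ) + 1 < n ∧ a i = 0) →
      IsStrongDeformation (tesler a₀) (tesler a)) ∧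
    IsDeformation (tesler (1 : Fin n → ℝ)) (tesler a) := by
  refine ⟨isDeformation_tesler ha₀ ha, fun hpos => ⟨isWeakDeformation_tesler ha₀ ha hpos, ?_⟩,
    fun ⟨i, hi, hai⟩ => isStrongDeformation_tesler ha₀ ha hi hai,
    isDeformation_tesler (fun _ => one_pos) ha⟩
  rw [NormallyEquivalent, normalFan_tesler (fun i => (ha₀ i).le) fun i _ => ha₀ i,
    normalFan_tesler ha hpos]
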